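/- Let $G=(V,\mathcal E)$ be a finite simple undirected graph on $n=|V|\ge 1$ queues, let $\mathcal N(i)$ be the set of neighbours of $i$, and let $S=\{\sigma\in\{0,1\}^V:\ \sigma_i+\sigma_j\le 1\text{ for all }(i,j)\in\mathcal E\}$ be the set of available schedules. Write $\sigma\cdot W=\sum_i\sigma_iW_i$ and $(x)_+=\max\{x,0\}$. **Combined BP–ES oracle.** An advice is a triple $a=(\rho,\sigma,m)$ with $\rho\in\{0,1\}^V$, $\sigma\in S$ and non-negative integer messages $m_{i\to j},m_{j\to i}$ for every $(i,j)\in\mathcal E$. Given weights $W\in\mathbb Z_+^V$ and an advice $a=(\rho,\sigma,m)$, the oracle returns the schedule $\widehat\sigma$ and the updated advice $(\widehat\rho,\widehat\sigma,\widehat m)$, where * $\widehat m_{i\to j}=\bigl(W_i-\sum_{k\in\mathcal N(i)\setminus\{j\}}m_{k\to i}\bigr)_+$; * $\widehat\rho$ is $\rho$ with the coordinate $\rho_i$ of a uniformly random queue $i\in V$ replaced by $\rho_i+1 \bmod 2$; * with $\delta_i=1$ if $W_i>\sum_{j\in\mathcal N(i)}m_{j\to i}$ and $\delta_i=0$ otherwise,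 $\widehat\sigma=\rho$ if $\rho\in S$, $\rho\cdot W>\sigma\cdot W$ and, in case $\delta\in S$, also $\rho\cdot W>\delta\cdot W$; else $\widehat\sigma=\delta$ if $\delta\in S$ and $\delta\cdot W>\sigma\cdot W$; else $\widehat\sigma=\sigma$. **Scheduling algorithm.** Let $f(x)=x^a$ and $g(x)=x^b$. The arrivals $A_i(t)\in\{0,1\}$, $i\in V$, $t\in\mathbb Z_+$, are independent Bernoulli variables of mean $\lambda_i\in[0,1]$, independent of the randomness of the oracle. The state $X(t)=(\sigma(t),W(t),a(t),Q(t))$, with $\sigma(t)\in S$, $W(t),Q(t)\in\mathbb Z_+^V$ and $a(t)$ an advice, evolves as follows: * $Q_i(t+1)=Q_i(t)+A_i(t)-\sigma_i(t)\,\mathbf 1_{\{Q_i(t)>0\}}$; * $(\sigma(t+1),a(t+1))$ is the oracle's answer to the query $(W(t),a(t))$; * with $U_i(t)=\max\{f(Q_i(t)),\,g(\max_jQ_j(t))\}$, $W_i(t+1)$ is the integer closest to $U_i(t+1)$ (ties are rounded up) if $|W_i(t)-U_i(t+1)|\ge 2$, and $W_i(t+1)=W_i(t)$ otherwise. **Claim.**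 If $0<b<a<1$, then this algorithm is throughput-optimal: for every $\lambda\in[0,1]^V$ for which some $s$ in the convex hull of $S$ satisfies $\lambda_i<s_i$ for all $i\in V$, the Markov chain $X(t)$ is positive recurrent. Here a state $x$ is positive recurrent if, for $X(0)=x$, the return time $\inf\{t\ge1:X(t)=x\}$ is almost surely finite and has finite expectation; and the (not necessarily irreducible) chain is positive recurrent if there is a finite set of positive recurrent states that is reached in finite expected time from every initial state. -/

import Mathlib

open MeasureTheory ProbabilityTheory
open scoped ENNReal

namespace OracleScheduling

/-! ### Time-homogeneous Markov chains with discrete state space -/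

section Chain

variable {X : Type*} [MeasurableSpace X] [DiscreteMeasurableSpace X]

/-- The Markov kernel of a transition law `P`, where `P x` is the law of the next state from `x`. -/
noncomputable def stepKernel (P : X → PMF X) : Kernel X X where
  toFun x := (P x).toMeasure
  measurable' := Measurable.of_discrete

instance (P : X → PMF X) : IsMarkovKernel (stepKernel P) :=
  ⟨fun x => inferInstanceAs (IsProbabilityMeasure (P x).toMeasure)⟩

/-- Given the history up to time `n`, the next state is drawn from the current state only. -/
noncomputable def historyKernel (P : X → PMF X) (n : ℕ) :
    Kernel ((i : Finset.Iic n) → (fun _ : ℕ => X) i) X :=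
  (stepKernel P).comap (fun h => h ⟨n, Finset.mem_Iic.2 le_rfl⟩) (measurable_pi_apply _)

instance (P : X → PMF X) (n : ℕ) : IsMarkovKernel (historyKernel P n) := by
  unfold historyKernel; infer_instance

/-- The law of the chain `(X(0), X(1), …)` with transition law `P` and `X(0) = x`. -/
noncomputable def pathLaw (P : X → PMF X) (x : X) : Measure (ℕ → X) :=
  Kernel.traj (X := fun _ => X) (historyKernel P) 0 (fun _ => x)

/-- `inf {t ≥ 1 : X(t) ∈ B}`, which is `⊤` if the trajectory is never in `B` at a time `t ≥ 1`. -/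
noncomputable def hitTime (B : Set X) (ω : ℕ → X) : ℕ∞ :=
  ⨅ (t : ℕ) (_ : 1 ≤ t ∧ ω t ∈ B), (t : ℕ∞)

/-- `E[inf {t ≥ 1 : X(t) ∈ B} | X(0) = x]`. -/
noncomputable def expHitTime (P : X → PMF X) (B : Set X) (x : X) : ℝ≥0∞ :=
  ∫⁻ ω, (hitTime B ω : ℝ≥0∞) ∂(pathLaw P x)

/-- The chain started in `x` returns to `x` with probability one. -/
def IsRecurrentState (P : X → PMF X) (x : X) : Prop :=
  ∀ᵐ ω ∂(pathLaw P x), hitTime {x} ω < ⊤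

/-- A recurrent state with finite expected return time. -/
def IsPositiveRecurrentState (P : X → PMF X) (x : X) : Prop :=
  IsRecurrentState P x ∧ expHitTime P {x} x < ⊤

/-- Positive recurrence of a chain that need not be irreducible: there is a finite set of positive
recurrent states which is reached in finite expected time from every initial state.
(For an irreducible chain this says that some state, equivalently every state, is positive
recurrent.) -/
def IsPositiveRecurrentChain (P : X → PMF X) : Prop :=
  ∃ F : Set X, F.Finite ∧ (∀ y ∈ F, IsPositiveRecurrentState P y) ∧
    ∀ x, expHitTime P F x < ⊤

end Chain

/-! ### The queueing network -/

section Network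

variable {V : Type*} [Fintype V]

/-- `σ · W`. -/
def weight (σ : V → Fin 2) (W : V → ℕ) : ℕ := ∑ i, (σ i : ℕ) * W i

/-- The capacity region: the convex hull of the available schedules. -/
def capacityRegion (S : Set (V → Fin 2)) : Set (V → ℝ) :=
  convexHull ℝ ((fun σ i => ((σ i : ℕ) : ℝ)) '' S)

/-- `Λᵒ`: arrival rates strictly below some point of the capacity region in every component. -/
def StrictlyAdmissible (S : Set (V → Fin 2)) (lam : V → unitInterval) : Prop :=
  ∃ s ∈ capacityRegion S, ∀ i, (lam i : ℝ) < s i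

/-- The law of one slot's arrivals: independent Bernoulli variables, `A i = 1` having
probability `lam i`. -/
noncomputable def arrivalLaw [DecidableEq V] (lam : V → unitInterval) : PMF (V → Fin 2) :=
  PMF.ofFintype
    (fun A => ∏ i, ENNReal.ofReal (if A i = 1 then (lam i : ℝ) else 1 - (lam i : ℝ))) (by
      rw [← Fintype.prod_sum
        (fun i (e : Fin 2) => ENNReal.ofReal (if e = 1 then (lam i : ℝ) else 1 - (lam i : ℝ)))]
      refine Finset.prod_eq_one fun i _ => ?_
      rw [Fin.sum_univ_two, if_neg (by decide), if_pos rfl,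
        ← ENNReal.ofReal_add (sub_nonneg.2 (lam i).2.2) (lam i).2.1]
      simp)

/-- `max_i Q i`. -/
def maxQueue (Q : V → ℕ) : ℕ := Finset.univ.sup Q

/-- `Q i + A i - σ i` if queue `i` is non-empty, and `Q i + A i` otherwise. -/
def nextQueue (Q : V → ℕ) (A σ : V → Fin 2) : V → ℕ :=
  fun i => Q i + (A i : ℕ) - (if 0 < Q i then (σ i : ℕ) else 0)

/-- `U i = max {f (Q i), g (max_j Q j)}`. -/
noncomputable def target (f g : ℝ → ℝ) (Q : V → ℕ) (i : V) : ℝ :=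
  max (f (Q i)) (g (maxQueue Q))

/-- The weight is reset to the integer closest to `U i` if it is at distance at least `2` from
`U i`, and kept otherwise. -/
noncomputable def nextWeight (f g : ℝ → ℝ) (W Q : V → ℕ) : V → ℕ :=
  open Classical in
  fun i => if 2 ≤ |(W i : ℝ) - target f g Q i| then (round (target f g Q i)).toNat else W i

/-- An oracle system with advice space `𝔸`: to weights and an advice it returns at random an
available schedule and an updated advice. -/
abbrev Oracle (S : Set (V → Fin 2)) (𝔸 : Type*) := (V → ℕ) → 𝔸 → PMF (S × 𝔸)

/-- A state `(σ, W, a, Q)` of the network Markov chain. -/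
structure State (S : Set (V → Fin 2)) (𝔸 : Type*) where
  schedule : S
  weights : V → ℕ
  advice : 𝔸
  queue : V → ℕ

instance (S : Set (V → Fin 2)) (𝔸 : Type*) : MeasurableSpace (State S 𝔸) := ⊤

instance (S : Set (V → Fin 2)) (𝔸 : Type*) : DiscreteMeasurableSpace (State S 𝔸) :=
  ⟨fun _ => trivial⟩

/-- One time slot of the scheduling algorithm: the arrivals and the oracle's answer to the query
`(W(t), a(t))` are independent, `Q(t)` evolves under the current schedule `σ(t)`, the answer is
`(σ(t+1), a(t+1))`, and `W(t+1)` is computed from `W(t)` and `Q(t+1)`. -/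
noncomputable def transition [DecidableEq V] {S : Set (V → Fin 2)} {𝔸 : Type*} (O : Oracle S 𝔸)
    (f g : ℝ → ℝ) (lam : V → unitInterval) (x : State S 𝔸) : PMF (State S 𝔸) :=
  (arrivalLaw lam).bind fun A =>
    (O x.weights x.advice).map fun r =>
      { schedule := r.1
        weights := nextWeight f g x.weights (nextQueue x.queue A x.schedule.1)
        advice := r.2
        queue := nextQueue x.queue A x.schedule.1 }

/-- For all strictly admissible arrival rates the network Markov chain is positive recurrent. -/
def ThroughputOptimal [DecidableEq V] {S : Set (V → Fin 2)} {𝔸 : Type*} (O : Oracle S 𝔸)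
    (f g : ℝ → ℝ) : Prop :=
  ∀ lam : V → unitInterval, StrictlyAdmissible S lam → IsPositiveRecurrentChain (transition O f g lam)

end Network

/-! ### Wireless interference and the combined oracle -/

section Wireless

variable {V : Type*} [Fintype V] [DecidableEq V]

/-- Schedules in which interfering queues are never active together. -/
def wirelessSchedules (G : SimpleGraph V) : Set (V → Fin 2) :=
  {σ | ∀ i j, G.Adj i j → (σ i : ℕ) + (σ j : ℕ) ≤ 1}

/-- An advice `(ρ, σ, m)`: a search index, the best schedule found so far, and a message
`m (i → j)` for each of the two orientations of every edge. -/
structure Advice (G : SimpleGraph V) where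
  index : V → Fin 2
  best : wirelessSchedules G
  msg : G.Dart → ℕ

variable (G : SimpleGraph V) [DecidableRel G.Adj]

/-- `m̂ (i → j) = (W i - ∑_{k ∈ N(i) \ {j}} m (k → i))₊`; the subtraction of natural numbers is
the positive part of the difference. -/
def nextMsg (W : V → ℕ) (m : G.Dart → ℕ) : G.Dart → ℕ :=
  fun d => W d.fst - ∑ e : G.Dart with e.snd = d.fst ∧ e.fst ≠ d.snd, m e

/-- The schedule suggested by the messages: `δ i = 1` iff `W i > ∑_{j ∈ N(i)} m (j → i)`.
It need not be available. -/
def beliefSchedule (W : V → ℕ) (m : G.Dart → ℕ) : V → Fin 2 :=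
  fun i => if ∑ e : G.Dart with e.snd = i, m e < W i then 1 else 0

/-- The updated schedule: a best one among `σ` and those of `ρ`, `δ` that are available. -/
noncomputable def nextBest (W : V → ℕ) (a : Advice G) : wirelessSchedules G :=
  open Classical in
  let δ := beliefSchedule G W a.msg
  if h : a.index ∈ wirelessSchedules G ∧ weight a.best.1 W < weight a.index W ∧
      (δ ∈ wirelessSchedules G → weight δ W < weight a.index W) then
    ⟨a.index, h.1⟩
  else if h' : δ ∈ wirelessSchedules G ∧ weight a.best.1 W < weight δ W then
    ⟨δ, h'.1⟩
  else a.best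

/-- The combined oracle. One coordinate of the search index, chosen uniformly at random, is
flipped; the returned schedule, which is also stored in the advice, and the messages are computed
from the received advice. -/
noncomputable def bpesOracle [Nonempty V] : Oracle (wirelessSchedules G) (Advice G) :=
  fun W a =>
    (PMF.uniformOfFintype V).map fun i =>
      (nextBest G W a,
        { index := Function.update a.index i (a.index i + 1)
          best := nextBest G W a
          msg := nextMsg G W a.msg })

end Wireless

end OracleScheduling

/-! The proof is a Foster–Lyapunov argument with L = ∑ᵢ ∑_{k<Qᵢ} f(k) + ∑_{η∈S} c(η,ρ)·(η·W − σ·W)₊,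
where c is `searchCost`. Belief propagation plays almost no role: its proposal is adopted only if it
improves the schedule, and its messages only have to stay bounded by the weights.

Two facts about the oracle suffice: the stored schedule never loses weight under the queried W, and
it becomes at least as heavy as the index ρ whenever ρ is available. The random walk ρ finds every
η: c(η,ρ) drops by at least 1 on average unless ρ = η, and then the gap to η closes. Weights move by
a bounded amount per slot, so the second sum drifts by at most −(total gap) + const
(`sum_searchPotential_le`).

The first sum drifts by at most ∑ f(Qᵢ)(λᵢ − σᵢ) + const. Since W agrees with f(Q) up to g(max Q) +
2, strict admissibility and the −(total gap) term bound the whole drift by n·g(max Q) − ε·f(max Q) +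
const (`expLyapunov_le`), which is negative for long queues because b < a.

Bounded queues do not bound the whole state, so Foster's criterion is applied on the absorbing set
of `Regular` states, entered after two steps; there, bounded queues leave finitely many states. Some
of these may fail to be positive recurrent, and `isPositiveRecurrentChain_of_finite` discards them
one at a time. -/

namespace OracleScheduling

set_option linter.unusedSectionVars false

/-! ### Hitting times as potentials, Foster's criterion, and reduction to positive recurrent states.
-/

section Chain

variable {X : Type*} [MeasurableSpace X]

/-- The transition operator of the chain killed on entering `B`. -/
noncomputable def killed (P : X → PMF X) (B : Set X) (u : X → ℝ≥0∞) (x : X) : ℝ≥0∞ :=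
  ∫⁻ y in Bᶜ, u y ∂(P x).toMeasure

/-- The Green potential `∑ n, Tⁿ φ` of `φ` for the operator `T = killed P B`. -/
noncomputable def potential (P : X → PMF X) (B : Set X) (φ : X → ℝ≥0∞) (x : X) : ℝ≥0∞ :=
  ∑' n : ℕ, (killed P B)^[n] φ x

/-- The trajectories that are not in `B` at the times `1, …, n`. -/
def avoid (B : Set X) (n : ℕ) : Set (ℕ → X) := {ω | ∀ t, 1 ≤ t → t ≤ n → ω t ∉ B}

lemma killed_mono (P : X → PMF X) (B : Set X) {u v : X → ℝ≥0∞} (h : ∀ x, u x ≤ v x) (x : X) :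
    killed P B u x ≤ killed P B v x :=
  lintegral_mono h

variable [DiscreteMeasurableSpace X]

lemma killed_add (P : X → PMF X) (B : Set X) (u v : X → ℝ≥0∞) (x : X) :
    killed P B (fun y => u y + v y) x = killed P B u x + killed P B v x :=
  lintegral_add_left Measurable.of_discrete _

lemma potential_eq (P : X → PMF X) (B : Set X) (φ : X → ℝ≥0∞) (x : X) :
    potential P B φ x = φ x + killed P B (potential P B φ) x := by
  unfold potential
  rw [tsum_eq_zero_add' ENNReal.summable]
  congr 1
  unfold killed
  rw [lintegral_tsum fun _ => Measurable.of_discrete.aemeasurable]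
  refine tsum_congr fun n => ?_
  rw [Function.iterate_succ_apply']

/-- The potential of `φ` is the least solution of `φ + T v ≤ v`. -/
lemma potential_le (P : X → PMF X) (B : Set X) (φ v : X → ℝ≥0∞)
    (h : ∀ x, φ x + killed P B v x ≤ v x) (x : X) : potential P B φ x ≤ v x := by
  have key : ∀ n x, ∑ k ∈ Finset.range n, (killed P B)^[k] φ x ≤ v x := by
    intro n
    induction n with
    | zero => intro x; simp
    | succ n ih =>
      intro x
      rw [Finset.sum_range_succ']
      simp only [Function.iterate_succ_apply', Function.iterate_zero, id]
      refine le_trans ?_ (h x)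
      rw [add_comm]
      gcongr
      refine le_trans (le_of_eq ?_) (killed_mono P B ih x)
      unfold killed
      rw [lintegral_finsetSum _ fun _ _ => Measurable.of_discrete]
  unfold potential
  rw [ENNReal.tsum_eq_iSup_nat]
  exact iSup_le fun n => key n x

lemma measurableSet_avoid (B : Set X) (n : ℕ) : MeasurableSet (avoid B n) := by
  have : avoid B n = ⋂ t : ℕ, ⋂ (_ : 1 ≤ t), ⋂ (_ : t ≤ n), {ω : ℕ → X | ω t ∈ Bᶜ} := by
    ext ω; simp [avoid]
  rw [this]
  refine MeasurableSet.iInter fun t => MeasurableSet.iInter fun _ => MeasurableSet.iInter fun _ => ?_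
  exact (MeasurableSet.of_discrete (s := Bᶜ)).preimage (measurable_pi_apply t)

lemma lintegral_pathLaw_zero (P : X → PMF X) (x : X) (u : X → ℝ≥0∞) :
    ∫⁻ ω, u (ω 0) ∂(pathLaw P x) = u x := by
  unfold pathLaw
  rw [Kernel.lintegral_traj]
  · simp [Function.updateFinset]
  · exact Measurable.of_discrete.comp (measurable_pi_apply 0)

/-- The Markov property in integrated form, with `φ` an arbitrary functional of the history up to
time `n`. -/
lemma lintegral_pathLaw_succ (P : X → PMF X) (x : X) (n : ℕ)
    (φ : ((i : Finset.Iic n) → (fun _ : ℕ => X) i) → ℝ≥0∞) (hφ : Measurable φ) (u : X → ℝ≥0∞) :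
    ∫⁻ ω, φ (Preorder.frestrictLe n ω) * u (ω (n + 1)) ∂(pathLaw P x) =
      ∫⁻ ω, φ (Preorder.frestrictLe n ω) * ∫⁻ y, u y ∂(P (ω n)).toMeasure ∂(pathLaw P x) := by
  have hu : Measurable u := Measurable.of_discrete
  have hg : Measurable fun z : X => ∫⁻ y, u y ∂(P z).toMeasure := Measurable.of_discrete
  have hm := Kernel.partialTraj_compProd_eq_map_traj (X := fun _ => X) (κ := historyKernel P)
    (Nat.zero_le n) (x₀ := fun _ => x)
  have h1 : ∫⁻ ω, φ (Preorder.frestrictLe n ω) * u (ω (n + 1)) ∂(pathLaw P x) =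
      ∫⁻ z, φ z.1 * u z.2 ∂((pathLaw P x).map fun ω => (Preorder.frestrictLe n ω, ω (n + 1))) := by
    rw [lintegral_map]
    · exact (hφ.comp measurable_fst).mul (hu.comp measurable_snd)
    · exact (Preorder.measurable_frestrictLe n).prodMk (measurable_pi_apply _)
  have h2 : ∫⁻ ω, φ (Preorder.frestrictLe n ω) * ∫⁻ y, u y ∂(P (ω n)).toMeasure ∂(pathLaw P x) =
      ∫⁻ h, φ h * ∫⁻ y, u y ∂(P (h ⟨n, Finset.mem_Iic.2 le_rfl⟩)).toMeasure
        ∂((pathLaw P x).map (Preorder.frestrictLe n)) := by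
    rw [lintegral_map]
    · rfl
    · exact hφ.mul (hg.comp (measurable_pi_apply _))
    · exact Preorder.measurable_frestrictLe n
  rw [h1, h2]
  unfold pathLaw
  rw [← hm, Kernel.traj_map_frestrictLe_apply, Measure.lintegral_compProd]
  · refine lintegral_congr fun h => ?_
    dsimp only
    rw [lintegral_const_mul _ hu]
    rfl
  · exact (hφ.comp measurable_fst).mul (hu.comp measurable_snd)

lemma setLIntegral_avoid_succ (P : X → PMF X) (B : Set X) (x : X) (n : ℕ) (u : X → ℝ≥0∞) :
    ∫⁻ ω in avoid B (n + 1), u (ω (n + 1)) ∂(pathLaw P x) =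
      ∫⁻ ω in avoid B n, killed P B u (ω n) ∂(pathLaw P x) := by
  -- `D` is the event `avoid B n` read off from the history, so its indicator can serve as the
  -- functional `φ` of the Markov property.
  let D : Set ((i : Finset.Iic n) → (fun _ : ℕ => X) i) := {h | ∀ i, 1 ≤ i.1 → h i ∉ B}
  have hD : MeasurableSet D := by
    have : D = ⋂ i : Finset.Iic n, ⋂ (_ : 1 ≤ i.1), {h | h i ∈ Bᶜ} := by
      ext h; simp [D]
    rw [this]
    refine MeasurableSet.iInter fun i => MeasurableSet.iInter fun _ => ?_
    exact (MeasurableSet.of_discrete (s := Bᶜ)).preimage (measurable_pi_apply i)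
  have hDn : ∀ ω : ℕ → X, Preorder.frestrictLe n ω ∈ D ↔ ω ∈ avoid B n := by
    intro ω
    constructor
    · intro h t h1 h2
      exact h ⟨t, Finset.mem_Iic.2 h2⟩ h1
    · intro h i h1
      exact h i.1 h1 (Finset.mem_Iic.1 i.2)
  have hsucc : ∀ ω : ℕ → X, ω ∈ avoid B (n + 1) ↔ ω ∈ avoid B n ∧ ω (n + 1) ∈ Bᶜ := by
    intro ω
    constructor
    · exact fun h => ⟨fun t h1 h2 => h t h1 (by omega), h _ (by omega) le_rfl⟩
    · rintro ⟨h, h'⟩ t h1 h2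
      rcases Nat.lt_or_ge n t with h3 | h3
      · obtain rfl : t = n + 1 := by omega
        exact h'
      · exact h t h1 h3
  have key := lintegral_pathLaw_succ P x n (D.indicator 1) (measurable_one.indicator hD)
    (Bᶜ.indicator u)
  rw [← lintegral_indicator (measurableSet_avoid B _),
    ← lintegral_indicator (measurableSet_avoid B _)]
  refine Eq.trans (lintegral_congr fun ω => ?_) (key.trans (lintegral_congr fun ω => ?_))
  · by_cases h1 : ω ∈ avoid B n <;> by_cases h2 : ω (n + 1) ∈ Bᶜ <;>
      simp [Set.indicator, hDn, hsucc, h1, h2]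
  · rw [lintegral_indicator MeasurableSet.of_discrete]
    by_cases h1 : ω ∈ avoid B n <;> simp [Set.indicator, hDn, h1, killed]

lemma pathLaw_avoid (P : X → PMF X) (B : Set X) (x : X) (n : ℕ) :
    pathLaw P x (avoid B n) = (killed P B)^[n] (fun _ => 1) x := by
  -- The terminal function `u` must vary in the induction: peeling off the last step replaces it by
  -- `killed P B u`.
  have key : ∀ (n : ℕ) (u : X → ℝ≥0∞),
      ∫⁻ ω in avoid B n, u (ω n) ∂(pathLaw P x) = (killed P B)^[n] u x := by
    intro n
    induction n with
    | zero =>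
      intro u
      have : avoid B 0 = Set.univ := by
        ext ω
        simp only [avoid, Set.mem_ofPred_eq, Set.mem_univ, iff_true]
        intro t h1 h2; omega
      rw [this, Measure.restrict_univ, lintegral_pathLaw_zero]
      rfl
    | succ n ih =>
      intro u
      rw [setLIntegral_avoid_succ, ih, Function.iterate_succ_apply]
  rw [← key n, setLIntegral_one]

lemma lt_hitTime_iff {X : Type*} (B : Set X) (n : ℕ) (ω : ℕ → X) : n < hitTime B ω ↔ ω ∈ avoid B n := by
  unfold hitTime
  rw [← ENat.add_one_le_iff (ENat.natCast_ne_top n)]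
  simp only [le_iInf_iff]
  constructor
  · intro h t h1 h2 h3
    have := h t ⟨h1, h3⟩
    norm_cast at this
    omega
  · rintro h t ⟨h1, h2⟩
    norm_cast
    by_contra h3
    exact h t h1 (by omega) h2

lemma _root_.ENat.toENNReal_eq_tsum (m : ℕ∞) :
    (m : ℝ≥0∞) = ∑' n : ℕ, if (n : ℕ∞) < m then 1 else 0 := by
  induction m with
  | top => simp
  | coe m =>
    rw [tsum_eq_sum (s := Finset.range m)]
    · rw [Finset.sum_congr rfl (g := fun _ => 1)]
      · simp
      · intro n hn
        simpa using hn
    · intro n hn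
      simpa using hn

lemma hitTime_eq_tsum {X : Type*} (B : Set X) (ω : ℕ → X) :
    (hitTime B ω : ℝ≥0∞) = ∑' n : ℕ, (avoid B n).indicator 1 ω := by
  classical
  rw [ENat.toENNReal_eq_tsum]
  refine tsum_congr fun n => ?_
  simp only [Set.indicator, lt_hitTime_iff, Pi.one_apply]

/-- The tail-sum formula E τ = ∑ₙ P(τ > n). -/
lemma expHitTime_eq_potential (P : X → PMF X) (B : Set X) (x : X) :
    expHitTime P B x = potential P B (fun _ => 1) x := by
  unfold expHitTime potential
  simp_rw [hitTime_eq_tsum]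
  rw [lintegral_tsum fun n => (measurable_one.indicator (measurableSet_avoid B n)).aemeasurable]
  refine tsum_congr fun n => ?_
  rw [lintegral_indicator_one (measurableSet_avoid B n), pathLaw_avoid]

/-- First-step analysis of the hitting time. -/
lemma expHitTime_eq (P : X → PMF X) (B : Set X) (x : X) :
    expHitTime P B x = 1 + killed P B (expHitTime P B) x := by
  have : expHitTime P B = potential P B fun _ => 1 := funext (expHitTime_eq_potential P B)
  rw [this]
  exact potential_eq P B _ x

/-- All later bounds on hitting times come from choosing a supersolution `v`. The value `⊤` is
allowed and makes the inequality trivial where nothing is known. -/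
lemma expHitTime_le (P : X → PMF X) (B : Set X) (v : X → ℝ≥0∞)
    (h : ∀ x, 1 + killed P B v x ≤ v x) (x : X) : expHitTime P B x ≤ v x := by
  rw [expHitTime_eq_potential]
  exact potential_le P B _ v h x

lemma isPositiveRecurrentState_of_lt_top (P : X → PMF X) (x : X)
    (h : expHitTime P {x} x < ⊤) : IsPositiveRecurrentState P x := by
  refine ⟨?_, h⟩
  have hm : Measurable fun ω : ℕ → X => (hitTime {x} ω : ℝ≥0∞) := by
    simp_rw [hitTime_eq_tsum]
    exact Measurable.tsum fun n => measurable_one.indicator (measurableSet_avoid _ n)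
  filter_upwards [ae_lt_top hm h.ne] with ω hω
  simpa using hω

lemma killed_add_inter (P : X → PMF X) (B C : Set X) (h : B ⊆ C) (u : X → ℝ≥0∞) (x : X) :
    killed P B u x = killed P C u x + ∫⁻ y in C \ B, u y ∂(P x).toMeasure := by
  unfold killed
  rw [← lintegral_union MeasurableSet.of_discrete]
  · congr 2
    ext y
    by_cases h1 : y ∈ C <;> by_cases h2 : y ∈ B <;> simp [h1, h2]
    exact h1 (h h2)
  · exact Set.disjoint_left.2 fun y h1 h2 => h1 h2.1

lemma prob_add_killed_one (P : X → PMF X) (C : Set X) (x : X) :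
    (P x).toMeasure C + killed P C (fun _ => 1) x = 1 := by
  unfold killed
  rw [setLIntegral_one, prob_add_prob_compl MeasurableSet.of_discrete]

/-- A state of `C` that is not positive recurrent may be removed from a set `C` that is hit in
finite expected time. -/
lemma expHitTime_diff_singleton_lt_top (P : X → PMF X) (C : Set X) (y : X) (hy : y ∈ C)
    (hC : ∀ x, expHitTime P C x < ⊤) (hrec : expHitTime P {y} y = ⊤) (x : X) :
    expHitTime P (C \ {y}) x < ⊤ := by
  set e := expHitTime P C with he
  -- `r x` and `s x` are the probabilities that the first visit to `C` at a time ≥ 1 occurs at `y`,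
  -- respectively elsewhere in `C`.
  set r := potential P C (fun x => (P x).toMeasure {y}) with hr
  set s := potential P C (fun x => (P x).toMeasure (C \ {y})) with hs
  have hre : ∀ x, r x = (P x).toMeasure {y} + killed P C r x := potential_eq P C _
  have hse : ∀ x, s x = (P x).toMeasure (C \ {y}) + killed P C s x := potential_eq P C _
  have hee : ∀ x, e x = 1 + killed P C e x := expHitTime_eq P C
  have hrs : ∀ x, r x + s x ≤ 1 := by
    intro x
    have h1 : ∀ x, potential P C (fun x => (P x).toMeasure {y} + (P x).toMeasure (C \ {y})) x ≤ 1 := by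
      refine potential_le P C _ (fun _ => 1) fun x => ?_
      refine le_of_le_of_eq (add_le_add ?_ le_rfl) (prob_add_killed_one P C x)
      rw [← measure_union Set.disjoint_sdiff_right MeasurableSet.of_discrete,
        Set.union_sdiff_self, Set.union_eq_self_of_subset_left (Set.singleton_subset_iff.2 hy)]
    refine le_trans (le_of_eq ?_) (h1 x)
    simp only [hr, hs, potential]
    rw [← ENNReal.tsum_add]
    refine tsum_congr fun n => ?_
    induction n generalizing x with
    | zero => rfl
    | succ n ih =>
      simp only [Function.iterate_succ_apply', ← killed_add]
      congr 1
      funext z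
      exact ih z
  -- If `s y = 0`, then `e + ⊤ * s` is a supersolution for hitting `{y}` whose value at `y` is `e
  -- y`, since `⊤ * 0 = 0`. The return time to `y` would then have finite mean.
  have hs0 : s y ≠ 0 := by
    intro h0
    have hv := expHitTime_le P {y} (fun x => e x + ⊤ * s x) (fun x => ?_) y
    · rw [hrec, h0, mul_zero, add_zero] at hv
      exact absurd (hC y) (not_lt.2 hv)
    · rw [killed_add_inter P {y} C (Set.singleton_subset_iff.2 hy), killed_add, ← add_assoc,
        ← add_assoc, ← hee, add_assoc]
      gcongr
      rw [hse x, mul_add, add_comm]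
      gcongr
      · calc _ ≤ ∫⁻ _ in C \ {y}, ⊤ ∂(P x).toMeasure := lintegral_mono fun _ => le_top
          _ = _ := by rw [lintegral_const, Measure.restrict_apply_univ]
      · exact (lintegral_const_mul _ Measurable.of_discrete).le
  have hr1 : r y < 1 := by
    refine lt_of_lt_of_le (ENNReal.lt_add_right ?_ hs0) (hrs y)
    exact ne_top_of_le_ne_top ENNReal.one_ne_top (le_self_add.trans (hrs y))
  -- `M` solves `M = e y + r y * M`: from `y`, excursions of mean length `e y` are repeated as long
  -- as they end at `y`. From a general `x`, the bound is one excursion plus a restart at `y` with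
  -- probability `r x`.
  set M := e y / (1 - r y) with hM
  have h1r : 1 - r y ≠ 0 := (tsub_pos_of_lt hr1).ne'
  have hMt : M ≠ ⊤ := ENNReal.div_ne_top (hC y).ne h1r
  have hMy : e y + r y * M = M := by
    have h2 : M * (1 - r y) = e y :=
      ENNReal.div_mul_cancel h1r (ne_top_of_le_ne_top ENNReal.one_ne_top tsub_le_self)
    rw [← h2, mul_comm (r y), ← mul_add, tsub_add_cancel_of_le hr1.le, mul_one]
  refine lt_of_le_of_lt (expHitTime_le P (C \ {y}) (fun x => e x + r x * M) (fun x => ?_) x) ?_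
  · rw [killed_add_inter P (C \ {y}) C Set.sdiff_subset, Set.sdiff_sdiff_cancel_left
      (Set.singleton_subset_iff.2 hy), killed_add, ← add_assoc, ← add_assoc, ← hee, add_assoc]
    refine add_le_add le_rfl ?_
    rw [hre x, add_mul, add_comm]
    refine add_le_add ?_ ?_
    · rw [lintegral_singleton, hMy, mul_comm]
    · unfold killed
      rw [lintegral_mul_const _ Measurable.of_discrete]
  · refine ENNReal.add_lt_top.2 ⟨hC x, ENNReal.mul_lt_top ?_ hMt.lt_top⟩
    exact lt_of_le_of_lt (le_self_add.trans (hrs x)) ENNReal.one_lt_top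

/-- A chain with a finite set that is hit in finite expected time from everywhere is positive
recurrent. -/
theorem isPositiveRecurrentChain_of_finite (P : X → PMF X) (C : Set X) (hf : C.Finite)
    (hC : ∀ x, expHitTime P C x < ⊤) : IsPositiveRecurrentChain P := by
  -- As long as `C` contains a state with infinite mean return time, that state can be removed;
  -- finiteness of `C` ends the process.
  induction hn : C.ncard generalizing C with
  | zero => exact ⟨C, hf, by simp [(Set.ncard_eq_zero hf).1 hn], hC⟩
  | succ n ih =>
    by_cases h : ∀ y ∈ C, expHitTime P {y} y < ⊤
    · exact ⟨C, hf, fun y hy => isPositiveRecurrentState_of_lt_top P y (h y hy), hC⟩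
    · push Not at h
      obtain ⟨y, hy, hye⟩ := h
      refine ih (C \ {y}) hf.sdiff
        (expHitTime_diff_singleton_lt_top P C y hy hC (top_le_iff.1 hye)) ?_
      rw [Set.ncard_sdiff_singleton_of_mem hy, hn]
      rfl

/-- Foster's criterion on an absorbing set `A`. -/
lemma expHitTime_lt_top_of_drift (P : X → PMF X) (A C : Set X) (V : X → ℝ≥0∞) (K : ℝ≥0∞)
    (hK : K ≠ ⊤) (hA : ∀ x ∈ A, (P x).support ⊆ A) (hV : ∀ x ∈ A, V x ≠ ⊤)
    (hdrift : ∀ x ∈ A, x ∉ C → 1 + ∫⁻ y, V y ∂(P x).toMeasure ≤ V x)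
    (hbound : ∀ x ∈ A, x ∈ C → 1 + ∫⁻ y, V y ∂(P x).toMeasure ≤ V x + K)
    (x : X) (hx : x ∈ A) : expHitTime P C x < ⊤ := by
  classical
  -- The surcharge `K` on `C` pays for the first step from `C`. It never enters `killed P C v`,
  -- which ignores `C`, and the value `⊤` is never seen from `A`, which is absorbing.
  let v : X → ℝ≥0∞ := fun x => if x ∈ A then (if x ∈ C then V x + K else V x) else ⊤
  refine lt_of_le_of_lt (expHitTime_le P C v (fun x => ?_) x) ?_
  · by_cases hx : x ∈ A
    · have h1 : killed P C v x ≤ ∫⁻ y, V y ∂(P x).toMeasure := by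
        unfold killed
        rw [← lintegral_indicator MeasurableSet.of_discrete]
        refine lintegral_mono_ae ?_
        have hsupp : ∀ᵐ y ∂(P x).toMeasure, y ∈ A := by
          rw [ae_iff, PMF.toMeasure_apply_eq_zero_iff _ MeasurableSet.of_discrete]
          exact Set.disjoint_left.2 fun y h1 h2 => h2 (hA x hx h1)
        filter_upwards [hsupp] with y hy
        by_cases hyC : y ∈ C <;> simp [v, hy, hyC]
      refine le_trans (add_le_add le_rfl h1) ?_
      by_cases hxC : x ∈ C
      · simpa [v, hx, hxC] using hbound x hx hxC
      · simpa [v, hx, hxC] using hdrift x hx hxC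
    · simp [v, hx]
  · simp only [v, hx, if_true]
    split_ifs
    · exact ENNReal.add_lt_top.2 ⟨(hV x hx).lt_top, hK.lt_top⟩
    · exact (hV x hx).lt_top

lemma _root_.PMF.toMeasure_eq_sum_dirac {X : Type*} [MeasurableSpace X] (p : PMF X) :
    p.toMeasure = Measure.sum fun x => p x • Measure.dirac x := by
  ext s hs
  rw [Measure.sum_apply _ hs, PMF.toMeasure_apply _ hs]
  refine tsum_congr fun x => ?_
  by_cases hx : x ∈ s <;> simp [hx, hs]

lemma _root_.PMF.lintegral_toMeasure (p : PMF X) (u : X → ℝ≥0∞) :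
    ∫⁻ x, u x ∂p.toMeasure = ∑' x, p x * u x := by
  rw [PMF.toMeasure_eq_sum_dirac, lintegral_sum_measure]
  refine tsum_congr fun x => ?_
  rw [lintegral_smul_measure, lintegral_dirac, smul_eq_mul]

lemma expHitTime_lt_top_of_support (P : X → PMF X) (C : Set X) (x : X)
    (hf : (P x).support.Finite) (h : ∀ y ∈ (P x).support, expHitTime P C y < ⊤) :
    expHitTime P C x < ⊤ := by
  rw [expHitTime_eq]
  refine ENNReal.add_lt_top.2 ⟨ENNReal.one_lt_top, ?_⟩
  refine lt_of_le_of_lt (setLIntegral_le_lintegral _ _) ?_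
  rw [PMF.lintegral_toMeasure, tsum_eq_sum (s := hf.toFinset)]
  · refine ENNReal.sum_lt_top.2 fun y hy => ENNReal.mul_lt_top ((P x).apply_lt_top y) ?_
    exact h y (by simpa using hy)
  · intro y hy
    have : P x y = 0 := by simpa using hy
    simp [this]

end Chain

/-! ### Sums against bound and mapped laws. -/

section Expectations

lemma _root_.PMF.tsum_bind_mul {α β : Type*} (p : PMF α) (q : α → PMF β) (u : β → ℝ≥0∞) :
    ∑' y, p.bind q y * u y = ∑' a, p a * ∑' y, q a y * u y := by
  simp_rw [PMF.bind_apply, ← ENNReal.tsum_mul_right, ← ENNReal.tsum_mul_left]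
  rw [ENNReal.tsum_comm]
  simp_rw [mul_assoc]

lemma _root_.PMF.tsum_map_mul {α β : Type*} (p : PMF α) (f : α → β) (u : β → ℝ≥0∞) :
    ∑' y, p.map f y * u y = ∑' a, p a * u (f a) := by
  rw [PMF.map, PMF.tsum_bind_mul]
  refine tsum_congr fun a => ?_
  congr 1
  rw [tsum_eq_single (f a)]
  · simp
  · intro y hy
    simp [hy]

end Expectations

/-! ### Means under the product Bernoulli law. -/

section Arrivals

variable {V : Type*} [Fintype V] [DecidableEq V]

/-- The probability of the arrival vector `A`, as a real number. -/
noncomputable def arrivalProb (lam : V → unitInterval) (A : V → Fin 2) : ℝ :=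
  ∏ i, if A i = 1 then (lam i : ℝ) else 1 - (lam i : ℝ)

lemma arrivalProb_nonneg (lam : V → unitInterval) (A : V → Fin 2) : 0 ≤ arrivalProb lam A := by
  refine Finset.prod_nonneg fun i _ => ?_
  split_ifs
  · exact (lam i).2.1
  · exact sub_nonneg.2 (lam i).2.2

lemma arrivalLaw_apply (lam : V → unitInterval) (A : V → Fin 2) :
    arrivalLaw lam A = ENNReal.ofReal (arrivalProb lam A) := by
  unfold arrivalLaw arrivalProb
  rw [PMF.ofFintype_apply, ENNReal.ofReal_prod_of_nonneg]
  intro i _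
  split_ifs
  · exact (lam i).2.1
  · exact sub_nonneg.2 (lam i).2.2

lemma sum_arrivalProb (lam : V → unitInterval) : ∑ A, arrivalProb lam A = 1 := by
  unfold arrivalProb
  rw [← Fintype.prod_sum fun i (e : Fin 2) => if e = 1 then (lam i : ℝ) else 1 - (lam i : ℝ)]
  refine Finset.prod_eq_one fun i _ => ?_
  simp [Fin.sum_univ_two]

lemma sum_arrivalProb_mul (lam : V → unitInterval) (i : V) :
    ∑ A, arrivalProb lam A * ((A i : ℕ) : ℝ) = lam i := by
  -- Writing `A i` as a product over all queues, with factor 1 away from `i`, keeps the summand a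
  -- product, so that the sum over `A` factorises.
  have h : ∀ A : V → Fin 2, arrivalProb lam A * ((A i : ℕ) : ℝ) =
      ∏ j, (if A j = 1 then (lam j : ℝ) else 1 - (lam j : ℝ)) *
        if j = i then ((A j : ℕ) : ℝ) else 1 := by
    intro A
    rw [Finset.prod_mul_distrib, Finset.prod_ite_eq' Finset.univ i]
    simp [arrivalProb]
  simp_rw [h]
  rw [← Fintype.prod_sum fun j (e : Fin 2) => (if e = 1 then (lam j : ℝ) else 1 - (lam j : ℝ)) *
        if j = i then ((e : ℕ) : ℝ) else 1]
  rw [Finset.prod_eq_single i]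
  · simp [Fin.sum_univ_two]
  · intro j _ hj
    simp [Fin.sum_univ_two, hj]
  · simp

lemma sum_arrivalProb_mul_affine (lam : V → unitInterval) (s : (V → Fin 2) → ℝ) (c d e : ℝ) :
    ∑ A, arrivalProb lam A * (c + s A - d + e) = c + ∑ A, arrivalProb lam A * s A - d + e := by
  simp only [mul_add, mul_sub, Finset.sum_add_distrib, Finset.sum_sub_distrib, ← Finset.sum_mul,
    sum_arrivalProb, one_mul]

end Arrivals

/-! ### Slowly growing functions -/

/-- On the natural numbers, `f` vanishes at `0` and is non-decreasing with increments at
most `1`. -/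
structure IsSlow (f : ℝ → ℝ) : Prop where
  zero : f 0 = 0
  le_succ : ∀ n : ℕ, f n ≤ f (n + 1 : ℕ)
  succ_le : ∀ n : ℕ, f (n + 1 : ℕ) ≤ f n + 1

namespace IsSlow

variable {f : ℝ → ℝ} (hf : IsSlow f)
include hf

lemma nonneg (n : ℕ) : 0 ≤ f n := by
  induction n with
  | zero => simp [hf.zero]
  | succ n ih => exact ih.trans (hf.le_succ n)

lemma le_self (n : ℕ) : f n ≤ n := by
  induction n with
  | zero => simp [hf.zero]
  | succ n ih => refine (hf.succ_le n).trans ?_; push_cast; linarith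

lemma abs_sub_le {m n : ℕ} (h1 : m ≤ n + 1) (h2 : n ≤ m + 1) : |f m - f n| ≤ 1 := by
  have h3 : m = n ∨ m = n + 1 ∨ n = m + 1 := by omega
  rcases h3 with rfl | rfl | rfl
  · simp
  · have := hf.le_succ n; have := hf.succ_le n
    rw [abs_le]; constructor <;> linarith
  · have := hf.le_succ m; have := hf.succ_le m
    rw [abs_le]; constructor <;> linarith

end IsSlow

/-- The increment bound is the subadditivity of x ↦ x^c. -/
lemma isSlow_rpow {c : ℝ} (h0 : 0 < c) (h1 : c < 1) : IsSlow fun x : ℝ => x ^ c where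
  zero := Real.zero_rpow h0.ne'
  le_succ n := Real.rpow_le_rpow n.cast_nonneg (by push_cast; linarith) h0.le
  succ_le n := by
    push_cast
    simpa using Real.rpow_add_le_add_rpow n.cast_nonneg zero_le_one h0.le h1.le

/-! ### One-slot changes of queues and weights, and the drift due to admissibility. -/

section Network

variable {V : Type*} [Fintype V]

lemma nextQueue_le (Q : V → ℕ) (A σ : V → Fin 2) (i : V) : nextQueue Q A σ i ≤ Q i + 1 := by
  have := (A i).2
  unfold nextQueue
  omega

lemma le_nextQueue (Q : V → ℕ) (A σ : V → Fin 2) (i : V) : Q i ≤ nextQueue Q A σ i + 1 := by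
  have := (σ i).2
  unfold nextQueue
  split_ifs <;> omega

lemma le_maxQueue (Q : V → ℕ) (i : V) : Q i ≤ maxQueue Q :=
  Finset.le_sup (f := Q) (Finset.mem_univ i)

lemma maxQueue_nextQueue_le (Q : V → ℕ) (A σ : V → Fin 2) :
    maxQueue (nextQueue Q A σ) ≤ maxQueue Q + 1 :=
  Finset.sup_le fun i _ => (nextQueue_le Q A σ i).trans (by have := le_maxQueue Q i; omega)

lemma maxQueue_le_nextQueue (Q : V → ℕ) (A σ : V → Fin 2) :
    maxQueue Q ≤ maxQueue (nextQueue Q A σ) + 1 :=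
  Finset.sup_le fun i _ => (le_nextQueue Q A σ i).trans
    (by have := le_maxQueue (nextQueue Q A σ) i; omega)

variable {f g : ℝ → ℝ}

lemma abs_target_nextQueue_sub_le (hf : IsSlow f) (hg : IsSlow g) (Q : V → ℕ) (A σ : V → Fin 2)
    (i : V) : |target f g (nextQueue Q A σ) i - target f g Q i| ≤ 1 :=
  (abs_max_sub_max_le_max _ _ _ _).trans (max_le
    (hf.abs_sub_le (nextQueue_le Q A σ i) (le_nextQueue Q A σ i))
    (hg.abs_sub_le (maxQueue_nextQueue_le Q A σ) (maxQueue_le_nextQueue Q A σ)))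

lemma target_le (hf : IsSlow f) (hg : IsSlow g) (Q : V → ℕ) (i : V) :
    target f g Q i ≤ maxQueue Q :=
  max_le ((hf.le_self _).trans (by exact_mod_cast le_maxQueue Q i)) (hg.le_self _)

lemma target_le_add (hf : IsSlow f) (hg : IsSlow g) (Q : V → ℕ) (i : V) :
    target f g Q i ≤ f (Q i) + g (maxQueue Q) :=
  max_le (by linarith [hg.nonneg (maxQueue Q)]) (by linarith [hf.nonneg (Q i)])

/-- `W` is arbitrary: a single update brings any weight close to its target. -/
lemma abs_nextWeight_sub_target_le (hf : IsSlow f) (W Q : V → ℕ) (i : V) :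
    |(nextWeight f g W Q i : ℝ) - target f g Q i| ≤ 2 := by
  unfold nextWeight
  split_ifs with h
  · have h0 : 0 ≤ target f g Q i := (hf.nonneg (Q i)).trans (le_max_left _ _)
    have h1 : 0 ≤ round (target f g Q i) := by
      rw [round_eq]; exact Int.floor_nonneg.2 (by linarith)
    have h2 : (((round (target f g Q i)).toNat : ℕ) : ℝ) = round (target f g Q i) := by
      exact_mod_cast Int.toNat_of_nonneg h1
    rw [h2, abs_sub_comm]
    exact (abs_sub_round _).trans (by norm_num)
  · exact (not_le.1 h).le

/-- 5 = 2 + 1 + 2: old weight to old target, old target to new target, new target to new weight. -/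
lemma abs_nextWeight_sub_le (hf : IsSlow f) (hg : IsSlow g) (W Q : V → ℕ) (A σ : V → Fin 2)
    (i : V) (h : |(W i : ℝ) - target f g Q i| ≤ 2) :
    |(nextWeight f g W (nextQueue Q A σ) i : ℝ) - W i| ≤ 5 := by
  have h1 := abs_nextWeight_sub_target_le (g := g) hf W (nextQueue Q A σ) i
  have h2 := abs_target_nextQueue_sub_le hf hg Q A σ i
  rw [abs_le] at *
  constructor <;> linarith [h.1, h.2, h1.1, h1.2, h2.1, h2.2]

lemma weight_cast (σ : V → Fin 2) (W : V → ℕ) :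
    (weight σ W : ℝ) = ∑ i, ((σ i : ℕ) : ℝ) * W i := by
  simp [weight]

lemma cast_fin_two_mem (e : Fin 2) : 0 ≤ ((e : ℕ) : ℝ) ∧ ((e : ℕ) : ℝ) ≤ 1 := by
  refine ⟨by positivity, ?_⟩
  have := e.2
  exact_mod_cast (by omega : (e : ℕ) ≤ 1)

lemma sum_le_weight_add (σ : V → Fin 2) (W : V → ℕ) (u : V → ℝ) (c : ℝ) (hc : 0 ≤ c)
    (h : ∀ i, u i ≤ W i + c) :
    ∑ i, ((σ i : ℕ) : ℝ) * u i ≤ weight σ W + Fintype.card V * c := by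
  have h1 : ∑ i, ((σ i : ℕ) : ℝ) * u i ≤ ∑ i, (((σ i : ℕ) : ℝ) * W i + c) := by
    refine Finset.sum_le_sum fun i _ => ?_
    obtain ⟨h2, h3⟩ := cast_fin_two_mem (σ i)
    nlinarith [mul_le_mul_of_nonneg_left (h i) h2]
  rw [weight_cast]
  refine h1.trans (le_of_eq ?_)
  rw [Finset.sum_add_distrib]
  simp

lemma weight_le_sum_add (σ : V → Fin 2) (W : V → ℕ) (u : V → ℝ) (c : ℝ) (hc : 0 ≤ c)
    (h : ∀ i, W i ≤ u i + c) :
    (weight σ W : ℝ) ≤ ∑ i, ((σ i : ℕ) : ℝ) * u i + Fintype.card V * c := by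
  have h1 : ∑ i, ((σ i : ℕ) : ℝ) * W i ≤ ∑ i, (((σ i : ℕ) : ℝ) * u i + c) := by
    refine Finset.sum_le_sum fun i _ => ?_
    obtain ⟨h2, h3⟩ := cast_fin_two_mem (σ i)
    nlinarith [mul_le_mul_of_nonneg_left (h i) h2]
  rw [weight_cast]
  refine h1.trans (le_of_eq ?_)
  rw [Finset.sum_add_distrib]
  simp

/-- The amount by which the weight of `σ` falls short of the weight of `η`. -/
noncomputable def gap (η σ : V → Fin 2) (W : V → ℕ) : ℝ :=
  max 0 ((weight η W : ℝ) - weight σ W)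

lemma gap_nonneg (η σ : V → Fin 2) (W : V → ℕ) : 0 ≤ gap η σ W := le_max_left _ _

lemma gap_le_gap_add (η σ : V → Fin 2) (W W' : V → ℕ) (c : ℝ) (hc : 0 ≤ c)
    (h : ∀ i, |(W' i : ℝ) - W i| ≤ c) :
    gap η σ W' ≤ gap η σ W + 2 * Fintype.card V * c := by
  have h1 := weight_le_sum_add η W' (fun i => (W i : ℝ)) c hc
    fun i => by linarith [(abs_le.1 (h i)).2]
  have h2 := weight_le_sum_add σ W (fun i => (W' i : ℝ)) c hc
    fun i => by linarith [(abs_le.1 (h i)).1]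
  rw [← weight_cast] at h1 h2
  have h3 : 0 ≤ (Fintype.card V : ℝ) * c := by positivity
  refine max_le ?_ ?_
  · linarith [gap_nonneg η σ W]
  · linarith [le_max_right (0 : ℝ) ((weight η W : ℝ) - weight σ W), gap.eq_1 η σ W]

/-- The primitive `∑ k < q, f k` summed over all queues. -/
noncomputable def queuePotential (f : ℝ → ℝ) (Q : V → ℕ) : ℝ :=
  ∑ i, ∑ k ∈ Finset.range (Q i), f k

lemma queuePotential_nonneg (hf : IsSlow f) (Q : V → ℕ) : 0 ≤ queuePotential f Q :=
  Finset.sum_nonneg fun _ _ => Finset.sum_nonneg fun k _ => hf.nonneg k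

/-- An arrival alone adds `f (Q i)`; a departure alone removes `f (Q i - 1)`, which is at least `f
(Q i) - 1`. This costs at most 1 per queue. Service wasted on an empty queue is harmless because `f
0 = 0`. -/
lemma queuePotential_nextQueue_le (hf : IsSlow f) (Q : V → ℕ) (A σ : V → Fin 2) :
    queuePotential f (nextQueue Q A σ) ≤ queuePotential f Q +
      ∑ i, f (Q i) * (((A i : ℕ) : ℝ) - ((σ i : ℕ) : ℝ)) + Fintype.card V := by
  have hcard : (Fintype.card V : ℝ) = ∑ _i : V, (1 : ℝ) := by simp
  unfold queuePotential
  rw [hcard, ← Finset.sum_add_distrib, ← Finset.sum_add_distrib]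
  refine Finset.sum_le_sum fun i _ => ?_
  unfold nextQueue
  have hA : A i = 0 ∨ A i = 1 := by generalize A i = e; revert e; decide
  have hσ : σ i = 0 ∨ σ i = 1 := by generalize σ i = e; revert e; decide
  generalize Q i = q
  rcases q with _ | q
  · rcases hA with hA | hA <;> simp [hA, hf.zero]
  · have := hf.succ_le q
    push_cast at this
    rcases hA with hA | hA <;> rcases hσ with hσ | hσ <;>
      simp [hA, hσ, Finset.sum_range_succ]
    linarith

/-- Strict admissibility turns the scheduling gaps into a negative drift of the queues. -/
lemma StrictlyAdmissible.drift [Nonempty V] {S : Set (V → Fin 2)} {lam : V → unitInterval}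
    (h : StrictlyAdmissible S lam) :
    ∃ ε > 0, ∀ (u : V → ℝ) (M : ℝ), (∀ i, 0 ≤ u i) →
      (∀ η ∈ S, ∑ i, ((η i : ℕ) : ℝ) * u i ≤ M) →
      ∀ j, ∑ i, u i * (lam i : ℝ) ≤ M - ε * u j := by
  obtain ⟨s, hs, hlt⟩ := h
  obtain ⟨i₀, -, hi₀⟩ := Finset.exists_min_image Finset.univ (fun i => s i - (lam i : ℝ))
    Finset.univ_nonempty
  -- ε is the smallest slack `s i - lam i`. The linear bound `M` passes from the schedules to their
  -- convex hull, hence to `s`.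
  refine ⟨s i₀ - lam i₀, sub_pos.2 (hlt i₀), fun u M hu hM j => ?_⟩
  have hsM : ∑ i, s i * u i ≤ M := by
    have hconv : Convex ℝ {s : V → ℝ | ∑ i, s i * u i ≤ M} := by
      refine convex_halfSpace_le ⟨fun x y => ?_, fun c x => ?_⟩ M
      · simp [add_mul, Finset.sum_add_distrib]
      · simp [Finset.mul_sum, mul_assoc]
    refine convexHull_min ?_ hconv hs
    rintro _ ⟨η, hη, rfl⟩
    exact hM η hη
  have h1 : (s i₀ - lam i₀) * u j ≤ ∑ i, (s i - lam i) * u i :=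
    (mul_le_mul_of_nonneg_right (hi₀ j (Finset.mem_univ j)) (hu j)).trans
      (Finset.single_le_sum (f := fun i => (s i - (lam i : ℝ)) * u i)
        (fun i _ => mul_nonneg (sub_pos.2 (hlt i)).le (hu i)) (Finset.mem_univ j))
  have h2 : ∑ i, (s i - lam i) * u i = ∑ i, s i * u i - ∑ i, u i * (lam i : ℝ) := by
    rw [← Finset.sum_sub_distrib]
    exact Finset.sum_congr rfl fun i _ => by ring
  linarith

end Network

/-! ### The random walk of the search index on the hypercube. -/

section Search

variable {V : Type*} [Fintype V] [DecidableEq V]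

/-- A function of the search index `ρ` that decreases by at least one on average when a random
coordinate of `ρ ≠ η` is flipped. -/
noncomputable def searchCost (η ρ : V → Fin 2) : ℝ :=
  (2 * Fintype.card V) ^ Fintype.card V * (2 - ((2 * Fintype.card V : ℝ)⁻¹) ^ hammingDist ρ η)

lemma searchCost_le (η ρ : V → Fin 2) :
    searchCost η ρ ≤ 2 * (2 * Fintype.card V) ^ Fintype.card V := by
  unfold searchCost
  have h1 : (0 : ℝ) ≤ (2 * Fintype.card V) ^ Fintype.card V := by positivity
  have h2 : (0 : ℝ) ≤ ((2 * Fintype.card V : ℝ)⁻¹) ^ hammingDist ρ η := by positivity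
  nlinarith

variable [Nonempty V]

lemma one_le_two_mul_card : (1 : ℝ) ≤ 2 * Fintype.card V := by
  have : 1 ≤ Fintype.card V := Fintype.card_pos
  have : (1 : ℝ) ≤ Fintype.card V := by exact_mod_cast this
  linarith

lemma one_le_searchCost (η ρ : V → Fin 2) : 1 ≤ searchCost η ρ := by
  unfold searchCost
  have h0 := one_le_two_mul_card (V := V)
  have h1 : (1 : ℝ) ≤ (2 * Fintype.card V) ^ Fintype.card V := one_le_pow₀ h0
  have h2 : ((2 * Fintype.card V : ℝ)⁻¹) ^ hammingDist ρ η ≤ 1 :=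
    pow_le_one₀ (by positivity) (inv_le_one_of_one_le₀ h0)
  nlinarith

lemma hammingDist_flip_lt (η ρ : V → Fin 2) (i : V) (h : ρ i ≠ η i) :
    hammingDist (Function.update ρ i (ρ i + 1)) η < hammingDist ρ η := by
  unfold hammingDist
  refine Finset.card_lt_card ⟨fun j hj => ?_, fun hsub => ?_⟩
  · simp only [Finset.mem_filter, Finset.mem_univ, true_and] at hj ⊢
    rcases eq_or_ne j i with rfl | hji
    · exact h
    · rwa [Function.update_of_ne hji] at hj
  · have h1 := hsub (Finset.mem_filter.2 ⟨Finset.mem_univ i, h⟩)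
    simp only [Finset.mem_filter, Finset.mem_univ, true_and, Function.update_self] at h1
    revert h h1
    generalize ρ i = x
    generalize η i = y
    revert x y
    decide

/-- Put n = |V|, B = 2n and let d be the distance from ρ to η. At least one of the n flips decreases
d and multiplies B^(-d) by at least B, so the mean of B^(-d) at least doubles, whatever the other
flips do. The gain is at least B^(-d) ≥ B^(-n), which the prefactor B^n in `searchCost` scales up to
1. -/
lemma sum_searchCost_flip_le (η ρ : V → Fin 2) (h : ρ ≠ η) :
    ∑ i, searchCost η (Function.update ρ i (ρ i + 1)) ≤
      Fintype.card V * (searchCost η ρ - 1) := by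
  obtain ⟨i₀, hi₀⟩ := Function.ne_iff.1 h
  have hn := one_le_two_mul_card (V := V)
  have hn0 : (Fintype.card V : ℝ) ≠ 0 := by
    intro h0; rw [h0] at hn; norm_num at hn
  set B : ℝ := 2 * Fintype.card V with hB
  have hB0 : 0 < B := by linarith
  set d := hammingDist ρ η with hd
  have hlt := hammingDist_flip_lt η ρ i₀ hi₀
  have h1 : B * B⁻¹ ^ d ≤ ∑ i, B⁻¹ ^ hammingDist (Function.update ρ i (ρ i + 1)) η := by
    refine le_trans ?_ (Finset.single_le_sum
      (f := fun i => B⁻¹ ^ hammingDist (Function.update ρ i (ρ i + 1)) η)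
      (fun i _ => by positivity) (Finset.mem_univ i₀))
    obtain ⟨k, hk⟩ : ∃ k, d = k + 1 := ⟨d - 1, by omega⟩
    rw [hk, pow_succ, mul_comm, mul_assoc, inv_mul_cancel₀ hB0.ne', mul_one]
    exact pow_le_pow_of_le_one (by positivity) (inv_le_one_of_one_le₀ hn) (by omega)
  have h2 : 1 ≤ B ^ Fintype.card V * B⁻¹ ^ d := by
    have h3 : B⁻¹ ^ Fintype.card V ≤ B⁻¹ ^ d :=
      pow_le_pow_of_le_one (by positivity) (inv_le_one_of_one_le₀ hn) hammingDist_le_card_fintype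
    calc (1 : ℝ) = B ^ Fintype.card V * B⁻¹ ^ Fintype.card V := by
          rw [← mul_pow, mul_inv_cancel₀ hB0.ne', one_pow]
      _ ≤ _ := by gcongr
  unfold searchCost
  rw [← Finset.mul_sum, Finset.sum_sub_distrib, ← hB, ← hd]
  simp only [Finset.sum_const, Finset.card_univ, nsmul_eq_mul]
  have hc : (Fintype.card V : ℝ) = B / 2 := by rw [hB]; ring
  have hp : 0 < B ^ Fintype.card V := by positivity
  rw [hc]
  have h4 := mul_le_mul_of_nonneg_left h1 hp.le
  nlinarith [mul_le_mul_of_nonneg_left h2 hB0.le]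

end Search

/-! ### The oracle, the absorbing set of regular states, and the Lyapunov drift. -/

section Wireless

variable {V : Type*} [Fintype V] [DecidableEq V] (G : SimpleGraph V) [DecidableRel G.Adj]

lemma weight_best_le_nextBest (W : V → ℕ) (a : Advice G) :
    weight a.best.1 W ≤ weight (nextBest G W a).1 W := by
  unfold nextBest
  dsimp only
  split_ifs with h h'
  · exact h.2.1.le
  · exact h'.2.le
  · exact le_rfl

/-- An available index is rejected only if σ or an available δ is at least as heavy, and then the
oracle's answer is too. -/
lemma weight_index_le_nextBest (W : V → ℕ) (a : Advice G) (ha : a.index ∈ wirelessSchedules G) :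
    weight a.index W ≤ weight (nextBest G W a).1 W := by
  unfold nextBest
  dsimp only
  split_ifs with h h'
  · exact le_rfl
  · by_contra hlt
    push Not at hlt
    exact h ⟨ha, h'.2.trans hlt, fun _ => hlt⟩
  · by_contra hlt
    push Not at hlt
    refine h ⟨ha, hlt, fun hδ => ?_⟩
    by_contra hle
    push Not at hle
    exact h' ⟨hδ, hlt.trans_le hle⟩

/-- New messages are bounded by the weights whatever the old ones were; nothing else about message
passing is needed. -/
lemma nextMsg_le (W : V → ℕ) (m : G.Dart → ℕ) (d : G.Dart) : nextMsg G W m d ≤ W d.fst :=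
  Nat.sub_le _ _

variable (f g : ℝ → ℝ)

/-- The state that follows `x` when the arrivals are `A` and the coordinate `i` of the search
index is flipped. -/
noncomputable def successor (x : State (wirelessSchedules G) (Advice G)) (A : V → Fin 2) (i : V) :
    State (wirelessSchedules G) (Advice G) where
  schedule := nextBest G x.weights x.advice
  weights := nextWeight f g x.weights (nextQueue x.queue A x.schedule.1)
  advice :=
    { index := Function.update x.advice.index i (x.advice.index i + 1)
      best := nextBest G x.weights x.advice
      msg := nextMsg G x.weights x.advice.msg }
  queue := nextQueue x.queue A x.schedule.1

/-- States whose weights are within distance `2` of their targets and whose schedule is the best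
one that the oracle has found. -/
def Synchronized (x : State (wirelessSchedules G) (Advice G)) : Prop :=
  (∀ i, |(x.weights i : ℝ) - target f g x.queue i| ≤ 2) ∧ x.schedule = x.advice.best

/-- Synchronized states whose messages are bounded in terms of the longest queue. -/
def Regular (x : State (wirelessSchedules G) (Advice G)) : Prop :=
  Synchronized G f g x ∧ ∀ d, x.advice.msg d ≤ maxQueue x.queue + 3

variable {f g}

lemma synchronized_successor (hf : IsSlow f) (x : State (wirelessSchedules G) (Advice G))
    (A : V → Fin 2) (i : V) : Synchronized G f g (successor G f g x A i) :=
  ⟨fun j => abs_nextWeight_sub_target_le hf _ _ j, rfl⟩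

lemma Synchronized.weights_le (hf : IsSlow f) (hg : IsSlow g)
    {x : State (wirelessSchedules G) (Advice G)} (hx : Synchronized G f g x) (i : V) :
    x.weights i ≤ maxQueue x.queue + 2 := by
  have h1 := (abs_le.1 (hx.1 i)).2
  have h2 := target_le hf hg x.queue i
  have : (x.weights i : ℝ) ≤ maxQueue x.queue + 2 := by linarith
  exact_mod_cast this

/-- The new messages are at most the old weights, hence at most the old longest queue plus 2. That
queue shrinks by at most 1 in the slot, which gives 3. -/
lemma regular_successor (hf : IsSlow f) (hg : IsSlow g)
    {x : State (wirelessSchedules G) (Advice G)} (hx : Synchronized G f g x)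
    (A : V → Fin 2) (i : V) : Regular G f g (successor G f g x A i) := by
  refine ⟨synchronized_successor G hf x A i, fun d => ?_⟩
  have h1 := nextMsg_le G x.weights x.advice.msg d
  have h2 := hx.weights_le G hf hg d.fst
  have h3 := maxQueue_le_nextQueue x.queue A x.schedule.1
  change nextMsg G x.weights x.advice.msg d ≤ maxQueue (nextQueue x.queue A x.schedule.1) + 3
  omega

lemma finite_regular (hf : IsSlow f) (hg : IsSlow g) (N : ℕ) :
    {x | Regular G f g x ∧ maxQueue x.queue ≤ N}.Finite := by
  let φ : (wirelessSchedules G × (V → ℕ)) × ((V → Fin 2) × wirelessSchedules G) ×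
      (G.Dart → ℕ) × (V → ℕ) → State (wirelessSchedules G) (Advice G) :=
    fun p => ⟨p.1.1, p.1.2, ⟨p.2.1.1, p.2.1.2, p.2.2.1⟩, p.2.2.2⟩
  have hfin : (((Set.univ : Set (wirelessSchedules G)) ×ˢ Set.Iic (fun _ : V => N + 2)) ×ˢ
      ((Set.univ : Set ((V → Fin 2) × wirelessSchedules G)) ×ˢ
        (Set.Iic (fun _ : G.Dart => N + 3) ×ˢ Set.Iic (fun _ : V => N)))).Finite :=
    (Set.finite_univ.prod (Set.finite_Iic _)).prod
      (Set.finite_univ.prod ((Set.finite_Iic _).prod (Set.finite_Iic _)))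
  refine (hfin.image φ).subset ?_
  rintro x ⟨hx, hN⟩
  refine ⟨((x.schedule, x.weights), (x.advice.index, x.advice.best), x.advice.msg, x.queue),
    ⟨⟨trivial, fun i => ?_⟩, trivial, fun d => ?_, fun i => ?_⟩, rfl⟩
  · exact (hx.1.weights_le G hf hg i).trans (Nat.add_le_add_right hN 2)
  · exact (hx.2 d).trans (Nat.add_le_add_right hN 3)
  · exact (le_maxQueue x.queue i).trans hN

open Classical in
/-- The sum of the scheduling gaps of all available schedules, weighted by search costs. -/
noncomputable def searchPotential (a : Advice G) (W : V → ℕ) : ℝ :=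
  ∑ η with η ∈ wirelessSchedules G, searchCost η a.index * gap η a.best.1 W

open Classical in
/-- The sum of the scheduling gaps of all available schedules. -/
noncomputable def totalGap (σ : V → Fin 2) (W : V → ℕ) : ℝ :=
  ∑ η with η ∈ wirelessSchedules G, gap η σ W

variable (f) in
/-- The Lyapunov function. -/
noncomputable def lyapunov (x : State (wirelessSchedules G) (Advice G)) : ℝ :=
  queuePotential f x.queue + searchPotential G x.advice x.weights

section

variable [Nonempty V]

lemma searchPotential_nonneg (a : Advice G) (W : V → ℕ) : 0 ≤ searchPotential G a W :=
  Finset.sum_nonneg fun η _ =>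
    mul_nonneg (zero_le_one.trans (one_le_searchCost η _)) (gap_nonneg _ _ _)

lemma lyapunov_nonneg (hf : IsSlow f) (x : State (wirelessSchedules G) (Advice G)) :
    0 ≤ lyapunov G f x :=
  add_nonneg (queuePotential_nonneg hf _) (searchPotential_nonneg G _ _)

/-- For each η, the mean of cost times gap falls by the current gap, up to a constant. The oracle
compares schedules under `W`, while the new gap is measured under `W'`; the constant is the maximal
cost times the change of the gap due to the weights. -/
lemma sum_searchCost_mul_gap_le (W W' : V → ℕ) (a : Advice G) (c : ℝ) (hc : 0 ≤ c)
    (hW : ∀ i, |(W' i : ℝ) - W i| ≤ c) (η : V → Fin 2) (hη : η ∈ wirelessSchedules G) :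
    ∑ i, searchCost η (Function.update a.index i (a.index i + 1)) *
        gap η (nextBest G W a).1 W' ≤
      Fintype.card V * (searchCost η a.index * gap η a.best.1 W - gap η a.best.1 W +
        2 * (2 * Fintype.card V) ^ Fintype.card V * (2 * Fintype.card V * c)) := by
  set n : ℝ := (Fintype.card V : ℝ) with hn
  have hn0 : 0 ≤ n := by positivity
  set K : ℝ := 2 * (2 * n) ^ Fintype.card V
  set γ := gap η (nextBest G W a).1 W
  have hγ' : gap η (nextBest G W a).1 W' ≤ γ + 2 * n * c := gap_le_gap_add _ _ _ _ c hc hW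
  have hγ0 : 0 ≤ γ := gap_nonneg _ _ _
  have hγ : γ ≤ gap η a.best.1 W := by
    refine max_le_max le_rfl ?_
    have : (weight a.best.1 W : ℝ) ≤ weight (nextBest G W a).1 W := by
      exact_mod_cast weight_best_le_nextBest G W a
    linarith
  have hcost : ∀ ρ, 0 ≤ searchCost η ρ := fun ρ => zero_le_one.trans (one_le_searchCost η ρ)
  have h1 : ∑ i, searchCost η (Function.update a.index i (a.index i + 1)) *
      gap η (nextBest G W a).1 W' ≤
      (∑ i, searchCost η (Function.update a.index i (a.index i + 1))) * γ +
        n * (K * (2 * n * c)) := by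
    have h2 : n * (K * (2 * n * c)) = ∑ _i : V, K * (2 * n * c) := by simp [hn]
    rw [h2, Finset.sum_mul, ← Finset.sum_add_distrib]
    refine Finset.sum_le_sum fun i _ => ?_
    have h3 := mul_le_mul_of_nonneg_left hγ' (hcost (Function.update a.index i (a.index i + 1)))
    have h4 := mul_le_mul_of_nonneg_right
      (searchCost_le η (Function.update a.index i (a.index i + 1)))
      (show 0 ≤ 2 * n * c by positivity)
    linarith
  have h2 : (∑ i, searchCost η (Function.update a.index i (a.index i + 1))) * γ ≤
      n * ((searchCost η a.index - 1) * gap η a.best.1 W) := by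
    have h6 : 0 ≤ searchCost η a.index - 1 := sub_nonneg.2 (one_le_searchCost _ _)
    -- At ρ = η the cost may rise after the flip, but the answer is now at least as heavy as η, so
    -- the gap it multiplies is 0. Otherwise the cost falls by 1 on average and the gap does not
    -- grow.
    by_cases hρ : a.index = η
    · have h5 : γ = 0 := by
        refine max_eq_left (sub_nonpos.2 ?_)
        have := weight_index_le_nextBest G W a (hρ ▸ hη)
        rw [hρ] at this
        exact_mod_cast this
      rw [h5, mul_zero]
      exact mul_nonneg hn0 (mul_nonneg h6 (gap_nonneg _ _ _))
    · have h7 := mul_le_mul_of_nonneg_right (sum_searchCost_flip_le η a.index hρ) hγ0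
      refine h7.trans ?_
      rw [mul_assoc]
      gcongr
  linarith

lemma sum_searchPotential_le (W W' : V → ℕ) (a : Advice G) (c : ℝ) (hc : 0 ≤ c)
    (hW : ∀ i, |(W' i : ℝ) - W i| ≤ c) :
    ∑ i, searchPotential G
        { index := Function.update a.index i (a.index i + 1)
          best := nextBest G W a
          msg := nextMsg G W a.msg } W' ≤
      Fintype.card V * (searchPotential G a W - totalGap G a.best.1 W +
        2 ^ Fintype.card V *
          (2 * (2 * Fintype.card V) ^ Fintype.card V * (2 * Fintype.card V * c))) := by
  classical
  unfold searchPotential totalGap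
  rw [Finset.sum_comm]
  refine (Finset.sum_le_sum fun η hη => sum_searchCost_mul_gap_le G W W' a c hc hW η
    (Finset.mem_filter.1 hη).2).trans ?_
  rw [← Finset.mul_sum, Finset.sum_add_distrib, Finset.sum_sub_distrib, Finset.sum_const,
    nsmul_eq_mul]
  gcongr
  -- There are at most 2^|V| available schedules.
  refine le_trans (Nat.cast_le.2 (Finset.card_le_univ _)) ?_
  simp

/-- The contribution to the drift bound that does not depend on the state. -/
noncomputable def driftConst (V : Type*) [Fintype V] : ℝ :=
  Fintype.card V + 2 ^ Fintype.card V *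
    (2 * (2 * Fintype.card V) ^ Fintype.card V * (2 * Fintype.card V * 5))

lemma sum_lyapunov_successor_le (hf : IsSlow f) (hg : IsSlow g)
    {x : State (wirelessSchedules G) (Advice G)} (hx : Synchronized G f g x) (A : V → Fin 2) :
    (∑ i, lyapunov G f (successor G f g x A i)) / Fintype.card V ≤
      lyapunov G f x + ∑ i, f (x.queue i) * (((A i : ℕ) : ℝ) - ((x.schedule.1 i : ℕ) : ℝ)) -
        totalGap G x.schedule.1 x.weights + driftConst V := by
  have hn : (0 : ℝ) < Fintype.card V := by exact_mod_cast Fintype.card_pos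
  have h1 := sum_searchPotential_le G x.weights
    (nextWeight f g x.weights (nextQueue x.queue A x.schedule.1)) x.advice 5 (by norm_num)
    fun i => abs_nextWeight_sub_le hf hg _ _ _ _ i (hx.1 i)
  have h2 := queuePotential_nextQueue_le hf x.queue A x.schedule.1
  have h3 : ∑ i, lyapunov G f (successor G f g x A i) =
      Fintype.card V * queuePotential f (nextQueue x.queue A x.schedule.1) +
        ∑ i, searchPotential G
          { index := Function.update x.advice.index i (x.advice.index i + 1)
            best := nextBest G x.weights x.advice
            msg := nextMsg G x.weights x.advice.msg }
          (nextWeight f g x.weights (nextQueue x.queue A x.schedule.1)) := by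
    simp only [lyapunov, Finset.sum_add_distrib, Finset.sum_const, nsmul_eq_mul,
      Finset.card_univ, successor]
  -- In a synchronized state the schedule serving the queues is the stored one, so both parts of the
  -- drift refer to the same σ.
  rw [div_le_iff₀ hn, h3, hx.2]
  rw [hx.2] at h1 h2
  unfold lyapunov driftConst
  have h4 := mul_le_mul_of_nonneg_left h2 hn.le
  nlinarith

lemma totalGap_ge (σ : V → Fin 2) (W : V → ℕ) (η : V → Fin 2) (hη : η ∈ wirelessSchedules G) :
    (weight η W : ℝ) - weight σ W ≤ totalGap G σ W := by
  classical
  unfold totalGap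
  refine (le_max_right 0 _).trans ?_
  exact Finset.single_le_sum (f := fun η => gap η σ W) (fun η _ => gap_nonneg η σ W)
    (Finset.mem_filter.2 ⟨Finset.mem_univ η, hη⟩)

/-- The expected value of the Lyapunov function after one step. -/
noncomputable def expLyapunov (f g : ℝ → ℝ) (lam : V → unitInterval)
    (x : State (wirelessSchedules G) (Advice G)) : ℝ :=
  ∑ A, arrivalProb lam A *
    ((∑ i, lyapunov G f (successor G f g x A i)) / Fintype.card V)

lemma expLyapunov_nonneg (hf : IsSlow f) (lam : V → unitInterval)
    (x : State (wirelessSchedules G) (Advice G)) : 0 ≤ expLyapunov G f g lam x :=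
  Finset.sum_nonneg fun A _ => mul_nonneg (arrivalProb_nonneg lam A)
    (div_nonneg (Finset.sum_nonneg fun _ _ => lyapunov_nonneg G hf _) (Nat.cast_nonneg _))

/-- The max-weight argument. The total gap dominates η·W − σ·W for every available η, and replacing
W by f(Q) costs at most 2 per queue for η and g(max Q) + 2 per queue for σ. Strict admissibility,
applied to `u = f(Q)` and to a longest queue `j`, then provides −ε·f(max Q). -/
lemma expLyapunov_le (hf : IsSlow f) (hg : IsSlow g) {lam : V → unitInterval}
    (hlam : StrictlyAdmissible (wirelessSchedules G) lam) :
    ∃ ε > 0, ∀ x : State (wirelessSchedules G) (Advice G), Synchronized G f g x →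
      expLyapunov G f g lam x ≤ lyapunov G f x + Fintype.card V * g (maxQueue x.queue) -
        ε * f (maxQueue x.queue) + (driftConst V + 4 * Fintype.card V) := by
  obtain ⟨ε, hε, hdrift⟩ := hlam.drift
  refine ⟨ε, hε, fun x hx => ?_⟩
  have h1 : expLyapunov G f g lam x ≤ lyapunov G f x +
      ∑ i, f (x.queue i) * ((lam i : ℝ) - ((x.schedule.1 i : ℕ) : ℝ)) -
        totalGap G x.schedule.1 x.weights + driftConst V := by
    refine (Finset.sum_le_sum fun A _ => mul_le_mul_of_nonneg_left
      (sum_lyapunov_successor_le G hf hg hx A) (arrivalProb_nonneg lam A)).trans (le_of_eq ?_)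
    have h2 : ∑ A, arrivalProb lam A *
        ∑ i, f (x.queue i) * (((A i : ℕ) : ℝ) - ((x.schedule.1 i : ℕ) : ℝ)) =
        ∑ i, f (x.queue i) * ((lam i : ℝ) - ((x.schedule.1 i : ℕ) : ℝ)) := by
      simp_rw [Finset.mul_sum]
      rw [Finset.sum_comm]
      refine Finset.sum_congr rfl fun i _ => ?_
      rw [← sum_arrivalProb_mul lam i]
      have h3 : ((x.schedule.1 i : ℕ) : ℝ) =
          ∑ A, arrivalProb lam A * ((x.schedule.1 i : ℕ) : ℝ) := by
        rw [← Finset.sum_mul, sum_arrivalProb, one_mul]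
      rw [h3, ← Finset.sum_sub_distrib, Finset.mul_sum, ← h3]
      exact Finset.sum_congr rfl fun A _ => by ring
    rw [sum_arrivalProb_mul_affine, h2]
  obtain ⟨j, -, hj⟩ := Finset.exists_mem_eq_sup Finset.univ Finset.univ_nonempty x.queue
  have hj' : maxQueue x.queue = x.queue j := hj
  have hW : ∀ i, f (x.queue i) ≤ x.weights i + 2 := fun i => by
    have h3 := (abs_le.1 (hx.1 i)).1
    have h4 : f (x.queue i) ≤ target f g x.queue i := le_max_left _ _
    linarith
  have hW' : ∀ i, (x.weights i : ℝ) ≤ f (x.queue i) + (g (maxQueue x.queue) + 2) := fun i => by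
    have h3 := (abs_le.1 (hx.1 i)).2
    have h4 := target_le_add hf hg x.queue i
    linarith
  have hg0 := hg.nonneg (maxQueue x.queue)
  have h5 := weight_le_sum_add x.schedule.1 x.weights (fun i => f (x.queue i))
    (g (maxQueue x.queue) + 2) (by linarith) hW'
  -- `M` is chosen so that the total gap and the service term cancel against those in `h1`.
  have h6 := hdrift (fun i => f (x.queue i))
    (totalGap G x.schedule.1 x.weights + ∑ i, ((x.schedule.1 i : ℕ) : ℝ) * f (x.queue i) +
      Fintype.card V * (g (maxQueue x.queue) + 4)) (fun i => hf.nonneg _) (fun η hη => by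
        have h7 := sum_le_weight_add η x.weights (fun i => f (x.queue i)) 2 (by norm_num) hW
        have h8 := totalGap_ge G x.schedule.1 x.weights η hη
        linarith) j
  have h9 : ∑ i, f (x.queue i) * ((lam i : ℝ) - ((x.schedule.1 i : ℕ) : ℝ)) =
      ∑ i, f (x.queue i) * (lam i : ℝ) - ∑ i, ((x.schedule.1 i : ℕ) : ℝ) * f (x.queue i) := by
    rw [← Finset.sum_sub_distrib]
    exact Finset.sum_congr rfl fun i _ => by ring
  rw [h9] at h1
  have h10 : f (maxQueue x.queue) = f (x.queue j) := by rw [hj']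
  rw [h10]
  linarith

lemma transition_eq (lam : V → unitInterval) (x : State (wirelessSchedules G) (Advice G)) :
    transition (bpesOracle G) f g lam x =
      (arrivalLaw lam).bind fun A => (PMF.uniformOfFintype V).map (successor G f g x A) := by
  unfold transition bpesOracle
  simp_rw [PMF.map_comp]
  rfl

lemma exists_of_mem_support_transition (lam : V → unitInterval)
    (x y : State (wirelessSchedules G) (Advice G))
    (hy : y ∈ (transition (bpesOracle G) f g lam x).support) :
    ∃ p : (V → Fin 2) × V, successor G f g x p.1 p.2 = y := by
  rw [transition_eq, PMF.mem_support_bind_iff] at hy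
  obtain ⟨A, -, hA⟩ := hy
  rw [PMF.mem_support_map_iff] at hA
  obtain ⟨i, -, hi⟩ := hA
  exact ⟨(A, i), hi⟩

lemma finite_support_transition (lam : V → unitInterval)
    (x : State (wirelessSchedules G) (Advice G)) :
    (transition (bpesOracle G) f g lam x).support.Finite :=
  (Set.finite_range fun p : (V → Fin 2) × V => successor G f g x p.1 p.2).subset
    fun y hy => exists_of_mem_support_transition G lam x y hy

lemma lintegral_lyapunov (hf : IsSlow f) (lam : V → unitInterval)
    (x : State (wirelessSchedules G) (Advice G)) :
    ∫⁻ y, ENNReal.ofReal (lyapunov G f y) ∂(transition (bpesOracle G) f g lam x).toMeasure =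
      ENNReal.ofReal (expLyapunov G f g lam x) := by
  have hn : (0 : ℝ) < Fintype.card V := by exact_mod_cast Fintype.card_pos
  rw [PMF.lintegral_toMeasure, transition_eq, PMF.tsum_bind_mul, tsum_fintype]
  unfold expLyapunov
  have hs : ∀ A, 0 ≤ ∑ i, lyapunov G f (successor G f g x A i) :=
    fun A => Finset.sum_nonneg fun i _ => lyapunov_nonneg G hf _
  rw [ENNReal.ofReal_sum_of_nonneg fun A _ =>
    mul_nonneg (arrivalProb_nonneg lam A) (div_nonneg (hs A) hn.le)]
  refine Finset.sum_congr rfl fun A _ => ?_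
  rw [ENNReal.ofReal_mul (arrivalProb_nonneg lam A), arrivalLaw_apply, PMF.tsum_map_mul,
    tsum_fintype]
  congr 1
  simp_rw [PMF.uniformOfFintype_apply]
  rw [← Finset.mul_sum, ENNReal.ofReal_div_of_pos hn, ENNReal.div_eq_inv_mul,
    ENNReal.ofReal_natCast, ENNReal.ofReal_sum_of_nonneg fun i _ => lyapunov_nonneg G hf _]

/-- The combined oracle is throughput-optimal for all slowly growing `f` and `g` such that `f`
dominates `g`. -/
theorem throughputOptimal_bpesOracle (hf : IsSlow f) (hg : IsSlow g)
    (hfg : ∀ ε > 0, ∀ K C : ℝ, ∃ N : ℕ, ∀ q : ℕ, N < q → K * g q - ε * f q + C ≤ 0) :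
    ThroughputOptimal (bpesOracle G) f g := by
  intro lam hlam
  obtain ⟨ε, hε, hdrift⟩ := expLyapunov_le G hf hg hlam
  -- The extra 1 makes the drift at most −1 once the longest queue exceeds `N`.
  obtain ⟨N, hN⟩ := hfg ε hε (Fintype.card V) (driftConst V + 4 * Fintype.card V + 1)
  let P := transition (bpesOracle G) f g lam
  let C : Set (State (wirelessSchedules G) (Advice G)) :=
    {x | Regular G f g x ∧ maxQueue x.queue ≤ N}
  have hreg : ∀ x, Regular G f g x → expHitTime P C x < ⊤ := by
    refine expHitTime_lt_top_of_drift P {x | Regular G f g x} C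
      (fun x => ENNReal.ofReal (lyapunov G f x))
      (ENNReal.ofReal (Fintype.card V * N + (driftConst V + 4 * Fintype.card V) + 1))
      ENNReal.ofReal_ne_top ?_ (fun _ _ => ENNReal.ofReal_ne_top) ?_ ?_
    · intro x hx y hy
      obtain ⟨p, rfl⟩ := exists_of_mem_support_transition G lam x y hy
      exact regular_successor G hf hg hx.1 _ _
    · intro x hx hxC
      have hNx : N < maxQueue x.queue := by
        by_contra hle
        exact hxC ⟨hx, not_lt.1 hle⟩
      rw [lintegral_lyapunov G hf, ← ENNReal.ofReal_one]
      have h1 := hdrift x hx.1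
      have h2 := hN _ hNx
      rw [← ENNReal.ofReal_add zero_le_one (expLyapunov_nonneg G hf lam x)]
      exact ENNReal.ofReal_le_ofReal (by linarith)
    · intro x hx hxC
      rw [lintegral_lyapunov G hf, ← ENNReal.ofReal_one]
      rw [← ENNReal.ofReal_add zero_le_one (expLyapunov_nonneg G hf lam x)]
      refine le_trans (ENNReal.ofReal_le_ofReal ?_) ENNReal.ofReal_add_le
      have h1 := hdrift x hx.1
      have h2 : g (maxQueue x.queue) ≤ N := (hg.le_self _).trans (by exact_mod_cast hxC.2)
      have h3 := mul_nonneg hε.le (hf.nonneg (maxQueue x.queue))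
      have h4 := mul_le_mul_of_nonneg_left h2 (Nat.cast_nonneg (α := ℝ) (Fintype.card V))
      linarith
  -- Any state is followed by a synchronized one, and that by a regular one. Each step has finitely
  -- many outcomes, so finiteness passes back to every initial state.
  have hsync : ∀ x, Synchronized G f g x → expHitTime P C x < ⊤ := by
    intro x hx
    refine expHitTime_lt_top_of_support P C x (finite_support_transition G lam x) fun y hy => ?_
    obtain ⟨p, rfl⟩ := exists_of_mem_support_transition G lam x y hy
    exact hreg _ (regular_successor G hf hg hx _ _)
  refine isPositiveRecurrentChain_of_finite P C (finite_regular G hf hg N) fun x => ?_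
  refine expHitTime_lt_top_of_support P C x (finite_support_transition G lam x) fun y hy => ?_
  obtain ⟨p, rfl⟩ := exists_of_mem_support_transition G lam x y hy
  exact hsync _ (synchronized_successor G hf x _ _)

end

end Wireless

end OracleScheduling

theorem corollary4 {V : Type*} [Fintype V] [DecidableEq V] [Nonempty V]
    (G : SimpleGraph V) [DecidableRel G.Adj] (a b : ℝ) (hb : 0 < b) (hba : b < a) (ha : a < 1) :
    OracleScheduling.ThroughputOptimal (OracleScheduling.bpesOracle G)
      (fun x : ℝ => x ^ a) (fun x : ℝ => x ^ b) := by
  refine OracleScheduling.throughputOptimal_bpesOracle G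
    (OracleScheduling.isSlow_rpow (hb.trans hba) ha)
    (OracleScheduling.isSlow_rpow hb (hba.trans ha)) fun ε hε K C => ?_
  have h1 : Filter.Tendsto (fun q : ℕ => (q : ℝ) ^ b) Filter.atTop Filter.atTop :=
    (tendsto_rpow_atTop hb).comp tendsto_natCast_atTop_atTop
  have h2 : Filter.Tendsto (fun q : ℕ => (q : ℝ) ^ (a - b)) Filter.atTop Filter.atTop :=
    (tendsto_rpow_atTop (sub_pos.2 hba)).comp tendsto_natCast_atTop_atTop
  -- Once ε·q^(a−b) ≥ K + 1, the difference K·q^b − ε·q^a is at most −q^b, and q^b ≥ C absorbs the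
  -- constant.
  obtain ⟨N, hN⟩ := Filter.eventually_atTop.1 ((h1.eventually_ge_atTop (max C 1)).and
    ((h2.eventually_ge_atTop ((K + 1) / ε)).and (Filter.eventually_gt_atTop 0)))
  refine ⟨N, fun q hq => ?_⟩
  obtain ⟨h3, h4, h5⟩ := hN q hq.le
  have hq0 : (0 : ℝ) < q := by exact_mod_cast h5
  have h6 : (q : ℝ) ^ a = (q : ℝ) ^ (a - b) * (q : ℝ) ^ b := by
    rw [← Real.rpow_add hq0]; congr 1; ring
  have h7 : K + 1 ≤ (q : ℝ) ^ (a - b) * ε := (div_le_iff₀ hε).1 h4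
  have h8 : C ≤ (q : ℝ) ^ b := (le_max_left _ _).trans h3
  have h9 := mul_le_mul_of_nonneg_right h7 (Real.rpow_nonneg hq0.le b)
  rw [h6]
  linarith
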